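/- Let $r\in\mathbb{N}_0$, let $(A_\ell)_{\ell\in\mathbb{N}_0}$ be a sequence of non-negative real numbers, and let $\beta>0$. Define the forward differences of $(\sqrt{A_\ell})_{\ell}$ recursively by $$\Delta^0_\ell=\sqrt{A_\ell},\qquad \Delta^i_\ell=\Delta^{i-1}_{\ell+1}-\Delta^{i-1}_\ell\quad (i\in\mathbb{N},\ \ell\in\mathbb{N}_0),$$ and define a sequence $(a_k)$ indexed by the half-integers $k\in\mathbb{Z}^*=\{\ell+\tfrac12:\ell\in\mathbb{Z}\}$ by $$a_{\ell+\frac12}=\sqrt{A_\ell}\ \text{ if }\ell\ge 0,\qquad a_{\ell+\frac12}=\sqrt{A_{-\ell-1}}\ \text{ if }\ell<0.$$ Then the following two statements are equivalent: (i) $\lim_{\ell\to\infty}A_\ell=0$, and there is a constant $c>0$ such that $|\Delta^r_\ell|\le c\,(1+\ell)^{-(1+\beta+r)}$ for all $\ell\in\mathbb{N}_0$. (ii) There are an even function $\alpha\in C^r(\mathbb{R})$ with $\alpha(k)=a_k$ for all $k\in\mathbb{Z}^*$ and a constant $\bar c>0$ such that $|\alpha^{(i)}(t)|\le \bar c\,(1+|t|)^{-(1+\beta+i)}$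 for all $t\in\mathbb{R}$ and all $i=0,\ldots,r$. -/

import Mathlib

/-- The symmetrised sequence on the half-integers belonging to a sequence `A`, indexed by integers:
`halfIntSeq A n` is the entry at the half-integer `n + 1/2`. It equals `√(A n)` for `n ≥ 0`,
and `√(A (-n - 1))` for `n < 0` (`Int.negSucc m` is the integer `-(m + 1)`). -/
noncomputable def halfIntSeq (A : ℕ → ℝ) : ℤ → ℝ
  | Int.ofNat m => √(A m)
  | Int.negSucc m => √(A m)

/-! ### Decay estimates for sequences -/

/-! From (ii) to (i), the mean value theorem bounds an `r`-th difference by the supremum of the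
`r`-th derivative to its right. Conversely, summing from infinity gives every difference of order `j
≤ r` its own rate `-(1 + β + j)`. Extend `√A` by zero to `ℤ`. Neighbouring degree-`r` Newton
interpolants differ by one term in the difference of order `r + 1` (`newton_shift`), so a smooth
step glues them. The `i`-th derivative kills Newton terms of degree below `i`, so only differences
decaying at least as fast as required remain. Adding the reflection makes the function even. -/

theorem rpow_neg_le_mul_of_abs_le_add_one {q t u : ℝ} (hq : 0 ≤ q) (h : |t| ≤ |u| + 1) :
    (1 + |u|) ^ (-q) ≤ 2 ^ q * (1 + |t|) ^ (-q) := by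
  have hu := abs_nonneg u
  have ht := abs_nonneg t
  have h1 : ((1 + |t|) / 2) ^ (-q) = 2 ^ q * (1 + |t|) ^ (-q) := by
    rw [Real.div_rpow (by positivity) (by norm_num), Real.rpow_neg (by norm_num : (0 : ℝ) ≤ 2),
      div_inv_eq_mul, mul_comm]
  rw [← h1]
  exact Real.rpow_le_rpow_of_nonpos (by positivity) (by linarith) (by linarith)

theorem rpow_neg_add_one_le_sub {p x : ℝ} (hp : 0 < p) (hx : 1 ≤ x) :
    x ^ (-(p + 1)) ≤ 2 ^ (p + 1) / p * (x ^ (-p) - (x + 1) ^ (-p)) := by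
  obtain ⟨ξ, ⟨h1, h2⟩, h3⟩ := exists_hasDerivAt_eq_slope (fun y : ℝ => y ^ (-p))
    (fun y : ℝ => (-p) * y ^ (-p - 1)) (lt_add_one x)
    (fun y hy => (Real.continuousAt_rpow_const y (-p)
      (Or.inl (by have := hy.1; linarith))).continuousWithinAt)
    (fun y hy => Real.hasDerivAt_rpow_const (Or.inl (by have := hy.1; linarith)))
  have h4 : x ^ (-p) - (x + 1) ^ (-p) = p * ξ ^ (-(p + 1)) := by
    have : (-p - 1) = -(p + 1) := by ring
    rw [this] at h3
    simp only [add_sub_cancel_left, div_one] at h3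
    linarith
  -- Since `x ≥ 1`, `ξ < x + 1 ≤ 2 * x`.
  have h5 : (2 * x) ^ (-(p + 1)) ≤ ξ ^ (-(p + 1)) :=
    Real.rpow_le_rpow_of_nonpos (by linarith) (by linarith) (by linarith)
  rw [h4]
  have h6 : (2 : ℝ) ^ (p + 1) * (2 * x) ^ (-(p + 1)) = x ^ (-(p + 1)) := by
    rw [Real.mul_rpow (by norm_num) (by linarith), ← mul_assoc, ← Real.rpow_add (by norm_num)]
    simp
  calc x ^ (-(p + 1)) = (2 : ℝ) ^ (p + 1) * (2 * x) ^ (-(p + 1)) := h6.symm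
    _ ≤ (2 : ℝ) ^ (p + 1) * ξ ^ (-(p + 1)) := by gcongr
    _ = _ := by field_simp

theorem abs_le_of_abs_fwdDiff_le {f : ℕ → ℝ} {p c : ℝ} (hp : 0 < p)
    (hf : Filter.Tendsto f Filter.atTop (nhds 0)) (hc : 0 < c)
    (h : ∀ l : ℕ, |fwdDiff 1 f l| ≤ c * (1 + (l : ℝ)) ^ (-(p + 1))) (l : ℕ) :
    |f l| ≤ c * (2 ^ (p + 1) / p) * (1 + (l : ℝ)) ^ (-p) := by
  have key : ∀ g : ℕ → ℝ, Filter.Tendsto g Filter.atTop (nhds 0) →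
      (∀ l : ℕ, |fwdDiff 1 g l| ≤ c * (1 + (l : ℝ)) ^ (-(p + 1))) →
      g l ≤ c * (2 ^ (p + 1) / p) * (1 + (l : ℝ)) ^ (-p) := by
    intro g hg hd
    set D := c * (2 ^ (p + 1) / p) with hD
    -- A monotone sequence with limit `0` is nonpositive; this replaces summing the tail.
    have hmono : Monotone (fun m : ℕ => g m - D * (1 + (m : ℝ)) ^ (-p)) := by
      refine monotone_nat_of_le_succ fun m => ?_
      have h1 := neg_le_of_abs_le (hd m)
      have h2 := mul_le_mul_of_nonneg_left
        (rpow_neg_add_one_le_sub hp (by simp : (1 : ℝ) ≤ 1 + (m : ℝ))) hc.le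
      rw [← mul_assoc, ← hD] at h2
      have h3 : (1 : ℝ) + ((m + 1 : ℕ) : ℝ) = 1 + m + 1 := by push_cast; ring
      simp only [fwdDiff] at h1
      rw [h3]
      linarith
    have hlim : Filter.Tendsto (fun m : ℕ => g m - D * (1 + (m : ℝ)) ^ (-p)) Filter.atTop
        (nhds (0 - D * 0)) := by
      refine hg.sub (Filter.Tendsto.const_mul _ ?_)
      exact (tendsto_rpow_neg_atTop hp).comp
        (Filter.tendsto_atTop_add_const_left _ _ tendsto_natCast_atTop_atTop)
    have := hmono.ge_of_tendsto hlim l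
    simp only [mul_zero, sub_zero] at this
    linarith
  refine abs_le'.2 ⟨key f hf h, key (fun m => -f m) (by simpa using hf.neg) fun m => ?_⟩
  have : fwdDiff 1 (fun m => -f m) m = -fwdDiff 1 f m := by simp only [fwdDiff]; ring
  rw [this, abs_neg]
  exact h m

theorem tendsto_fwdDiff_iterate_zero {f : ℕ → ℝ} (hf : Filter.Tendsto f Filter.atTop (nhds 0))
    (j : ℕ) : Filter.Tendsto ((fwdDiff 1)^[j] f) Filter.atTop (nhds 0) := by
  induction j with
  | zero => simpa using hf
  | succ j ih =>
    rw [Function.iterate_succ_apply']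
    have := (ih.comp (Filter.tendsto_add_atTop_nat 1)).sub ih
    rw [sub_zero] at this
    exact this

theorem exists_abs_fwdDiff_iterate_le_of_le {f : ℕ → ℝ} {β : ℝ} (hβ : 0 < β) {r : ℕ}
    (hf : Filter.Tendsto f Filter.atTop (nhds 0))
    (h : ∃ c : ℝ, 0 < c ∧ ∀ l : ℕ,
      |(fwdDiff 1)^[r] f l| ≤ c * (1 + (l : ℝ)) ^ (-(1 + β + (r : ℝ)))) {j : ℕ} (hj : j ≤ r) :
    ∃ c : ℝ, 0 < c ∧ ∀ l : ℕ,
      |(fwdDiff 1)^[j] f l| ≤ c * (1 + (l : ℝ)) ^ (-(1 + β + (j : ℝ))) := by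
  induction hj using Nat.decreasingInduction with
  | self => exact h
  | of_succ j hj ih =>
    obtain ⟨c, hc, hb⟩ := ih
    have hp : 0 < 1 + β + (j : ℝ) := by positivity
    refine ⟨c * (2 ^ (1 + β + (j : ℝ) + 1) / (1 + β + (j : ℝ))), by positivity,
      abs_le_of_abs_fwdDiff_le hp (tendsto_fwdDiff_iterate_zero hf j) hc fun l => ?_⟩
    rw [← Function.iterate_succ_apply' (fwdDiff 1) j f]
    convert hb l using 4
    push_cast
    ring

/-- No gain of decay is needed: order `r + 1` enters only through the blending term. -/
theorem exists_abs_fwdDiff_iterate_succ_le {f : ℕ → ℝ} {q : ℝ} (hq : 0 ≤ q) {r : ℕ}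
    (h : ∃ c : ℝ, 0 < c ∧ ∀ l : ℕ, |(fwdDiff 1)^[r] f l| ≤ c * (1 + (l : ℝ)) ^ (-q)) :
    ∃ c : ℝ, 0 < c ∧ ∀ l : ℕ, |(fwdDiff 1)^[r + 1] f l| ≤ c * (1 + (l : ℝ)) ^ (-q) := by
  obtain ⟨c, hc, hb⟩ := h
  refine ⟨c + c, by positivity, fun l => ?_⟩
  rw [Function.iterate_succ_apply']
  refine (abs_sub _ _).trans ?_
  rw [add_mul]
  refine add_le_add ((hb (l + 1)).trans ?_) (hb l)
  gcongr c * ?_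
  exact Real.rpow_le_rpow_of_nonpos (by positivity) (by push_cast; linarith) (by linarith)

/-! ### Extension by zero to the integers -/

/-- Extension of a sequence to the integers by zero. -/
def zeroExtend (f : ℕ → ℝ) : ℤ → ℝ
  | Int.ofNat m => f m
  | Int.negSucc _ => 0

theorem zeroExtend_natCast (f : ℕ → ℝ) (m : ℕ) : zeroExtend f m = f m := rfl

theorem zeroExtend_of_neg (f : ℕ → ℝ) {n : ℤ} (hn : n < 0) : zeroExtend f n = 0 := by
  obtain ⟨m, rfl⟩ := Int.eq_negSucc_of_lt_zero hn
  rfl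

theorem fwdDiff_iterate_zeroExtend_natCast (f : ℕ → ℝ) (j m : ℕ) :
    (fwdDiff 1)^[j] (zeroExtend f) (m : ℤ) = (fwdDiff 1)^[j] f m := by
  induction j generalizing m with
  | zero => rfl
  | succ j ih =>
    rw [Function.iterate_succ_apply', Function.iterate_succ_apply', fwdDiff, fwdDiff, ← ih m,
      ← ih (m + 1)]
    push_cast
    rfl

theorem fwdDiff_iterate_zeroExtend_of_lt (f : ℕ → ℝ) (j : ℕ) {n : ℤ} (hn : n < -(j : ℤ)) :
    (fwdDiff 1)^[j] (zeroExtend f) n = 0 := by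
  induction j generalizing n with
  | zero => exact zeroExtend_of_neg f (by simpa using hn)
  | succ j ih =>
    push_cast at hn
    rw [Function.iterate_succ_apply', fwdDiff, ih (by omega), ih (by omega), sub_zero]

theorem exists_abs_fwdDiff_iterate_zeroExtend_le {f : ℕ → ℝ} {q : ℝ} {j : ℕ}
    (h : ∃ c : ℝ, 0 < c ∧ ∀ l : ℕ, |(fwdDiff 1)^[j] f l| ≤ c * (1 + (l : ℝ)) ^ (-q)) :
    ∃ c : ℝ, 0 < c ∧ ∀ n : ℤ,
      |(fwdDiff 1)^[j] (zeroExtend f) n| ≤ c * (1 + |(n : ℝ)|) ^ (-q) := by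
  obtain ⟨c, hc, hb⟩ := h
  set g := (fwdDiff 1)^[j] (zeroExtend f)
  -- Extending by zero spoils the differences at only finitely many points, which the constant
  -- absorbs.
  obtain ⟨M, hM⟩ := ((Set.finite_Icc (-(j : ℤ)) 0).image
    (fun n : ℤ => |g n| / (1 + |(n : ℝ)|) ^ (-q))).bddAbove
  refine ⟨max c M, lt_max_of_lt_left hc, fun n => ?_⟩
  have hpos : 0 < (1 + |(n : ℝ)|) ^ (-q) := by positivity
  rcases lt_or_ge n (-(j : ℤ)) with hn | hn
  · rw [show g n = 0 from fwdDiff_iterate_zeroExtend_of_lt f j hn, abs_zero]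
    exact mul_nonneg (hc.le.trans (le_max_left _ _)) hpos.le
  rcases le_or_gt n 0 with hn0 | hn0
  · have := hM ⟨n, ⟨hn, hn0⟩, rfl⟩
    rw [div_le_iff₀ hpos] at this
    exact this.trans (by gcongr; exact le_max_right _ _)
  · lift n to ℕ using hn0.le
    rw [show g n = _ from fwdDiff_iterate_zeroExtend_natCast f j n]
    refine (hb n).trans ?_
    simp only [Int.cast_natCast, Nat.abs_cast]
    gcongr
    exact le_max_left _ _

/-! ### Newton's forward difference basis and its smooth blending -/

/-- The Newton polynomial `X (X - 1) ⋯ (X - j + 1) / j!`. -/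
noncomputable def newtonPoly (j : ℕ) : Polynomial ℝ :=
  Polynomial.C ((j.factorial : ℝ)⁻¹) * descPochhammer ℝ j

theorem newtonPoly_zero : newtonPoly 0 = 1 := by simp [newtonPoly]

theorem eval_zero_newtonPoly_succ (j : ℕ) : (newtonPoly (j + 1)).eval 0 = 0 := by
  simp [newtonPoly, descPochhammer_succ_left]

theorem eval_newtonPoly_succ (j : ℕ) (x : ℝ) :
    (newtonPoly (j + 1)).eval x
      = (newtonPoly (j + 1)).eval (x - 1) + (newtonPoly j).eval (x - 1) := by
  have h1 : (descPochhammer ℝ (j + 1)).eval x = x * (descPochhammer ℝ j).eval (x - 1) := by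
    simp [descPochhammer_succ_left]
  have h2 : (descPochhammer ℝ (j + 1)).eval (x - 1)
      = (descPochhammer ℝ j).eval (x - 1) * (x - 1 - j) := by
    simp [descPochhammer_succ_right]
  have h3 : (j.factorial : ℝ) ≠ 0 := by positivity
  simp only [newtonPoly, Polynomial.eval_mul, Polynomial.eval_C, h1, h2, Nat.factorial_succ]
  push_cast
  field_simp
  ring

theorem natDegree_newtonPoly_le (j : ℕ) : (newtonPoly j).natDegree ≤ j :=
  (Polynomial.natDegree_C_mul_le _ _).trans (descPochhammer_natDegree ℝ j).le

theorem iteratedDeriv_polynomial_eval (P : Polynomial ℝ) (i : ℕ) :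
    iteratedDeriv i (fun x => P.eval x) = fun x => (Polynomial.derivative^[i] P).eval x := by
  induction i with
  | zero => simp
  | succ i ih =>
    rw [iteratedDeriv_succ, ih, Function.iterate_succ_apply']
    ext x
    exact Polynomial.deriv _

/-- Pascal's rule makes recentring telescope, leaving only the top-order term. -/
theorem newton_shift (g : ℤ → ℝ) (n : ℤ) (s : ℝ) (r : ℕ) :
    ∑ j ∈ Finset.range (r + 1), (fwdDiff 1)^[j] g (n + 1) * (newtonPoly j).eval (s - 1)
      = ∑ j ∈ Finset.range (r + 1), (fwdDiff 1)^[j] g n * (newtonPoly j).eval s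
        + (fwdDiff 1)^[r + 1] g n * (newtonPoly r).eval (s - 1) := by
  have hstep : ∀ j, (fwdDiff 1)^[j] g (n + 1)
      = (fwdDiff 1)^[j] g n + (fwdDiff 1)^[j + 1] g n := fun j => by
    rw [Function.iterate_succ_apply', fwdDiff]; ring
  induction r with
  | zero => simp [newtonPoly_zero, hstep 0, fwdDiff]
  | succ r ih =>
    rw [Finset.sum_range_succ, ih, Finset.sum_range_succ _ (r + 1), eval_newtonPoly_succ r s,
      hstep (r + 1)]
    ring

/-- A smooth step, equal to `0` on `(-∞, 1/4]` and to `1` on `[3/4, ∞)`. -/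
noncomputable def smoothStep (s : ℝ) : ℝ := Real.smoothTransition (2 * s - 1 / 2)

theorem smoothStep_of_le {s : ℝ} (h : s ≤ 1 / 4) : smoothStep s = 0 :=
  Real.smoothTransition.zero_of_nonpos (by linarith)

theorem smoothStep_of_ge {s : ℝ} (h : 3 / 4 ≤ s) : smoothStep s = 1 :=
  Real.smoothTransition.one_of_one_le (by linarith)

theorem contDiff_smoothStep {n : ℕ∞} : ContDiff ℝ n smoothStep :=
  Real.smoothTransition.contDiff.comp (by fun_prop)

/-- The Newton basis of degree at most `r`, together with the function which blends
consecutive interpolation polynomials. -/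
noncomputable def blendBasis (r j : ℕ) (s : ℝ) : ℝ :=
  if j ≤ r then (newtonPoly j).eval s else smoothStep s * (newtonPoly r).eval (s - 1)

theorem contDiff_polynomial_eval (P : Polynomial ℝ) {n : ℕ∞} :
    ContDiff ℝ n (fun x => P.eval x) := by
  simpa using (Polynomial.contDiff_aeval (𝕜 := ℝ) P n)

theorem contDiff_blendBasis (r j : ℕ) {n : ℕ∞} : ContDiff ℝ n (blendBasis r j) := by
  unfold blendBasis
  split_ifs
  · exact contDiff_polynomial_eval _
  · exact contDiff_smoothStep.mul
      ((contDiff_polynomial_eval _).comp (contDiff_id.sub contDiff_const))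

theorem iteratedDeriv_blendBasis_of_lt {r i j : ℕ} (hj : j < i) (hi : i ≤ r) :
    iteratedDeriv i (blendBasis r j) = 0 := by
  have : blendBasis r j = fun s => (newtonPoly j).eval s := by
    ext s; simp [blendBasis, (hj.trans_le hi).le]
  rw [this, iteratedDeriv_polynomial_eval,
    Polynomial.iterate_derivative_eq_zero ((natDegree_newtonPoly_le j).trans_lt hj)]
  ext; simp

/-! ### The interpolating function -/

/-- The blended Newton interpolation of `g` on a neighbourhood of `[n, n + 1]`,
as a function of `s = t - n`. -/
noncomputable def localInterp (r : ℕ) (g : ℤ → ℝ) (n : ℤ) (s : ℝ) : ℝ :=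
  ∑ j ∈ Finset.range (r + 2), (fwdDiff 1)^[j] g n * blendBasis r j s

theorem localInterp_eq (r : ℕ) (g : ℤ → ℝ) (n : ℤ) (s : ℝ) :
    localInterp r g n s
      = ∑ j ∈ Finset.range (r + 1), (fwdDiff 1)^[j] g n * (newtonPoly j).eval s
        + (fwdDiff 1)^[r + 1] g n * (smoothStep s * (newtonPoly r).eval (s - 1)) := by
  rw [localInterp, Finset.sum_range_succ]
  congr 1
  · refine Finset.sum_congr rfl fun j hj => ?_
    rw [blendBasis, if_pos (by simpa [Nat.lt_succ_iff] using hj)]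
  · rw [blendBasis, if_neg (by omega)]

theorem localInterp_zero (r : ℕ) (g : ℤ → ℝ) (n : ℤ) : localInterp r g n 0 = g n := by
  rw [localInterp_eq, smoothStep_of_le (by norm_num), Finset.sum_range_succ']
  simp [eval_zero_newtonPoly_succ, newtonPoly_zero]

/-- Here the step is `1` at `s` and `0` at `s - 1`, so the blending term is exactly the remainder in
`newton_shift`. Agreement on an interval around the node gives smoothness there. -/
theorem localInterp_succ (r : ℕ) (g : ℤ → ℝ) (n : ℤ) {s : ℝ} (h1 : 3 / 4 ≤ s) (h2 : s ≤ 5 / 4) :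
    localInterp r g (n + 1) (s - 1) = localInterp r g n s := by
  rw [localInterp_eq, localInterp_eq, smoothStep_of_ge h1, smoothStep_of_le (by linarith),
    newton_shift]
  ring

theorem contDiff_localInterp (r : ℕ) (g : ℤ → ℝ) (n : ℤ) {m : ℕ∞} :
    ContDiff ℝ m (localInterp r g n) :=
  ContDiff.sum fun j _ => contDiff_const.mul (contDiff_blendBasis r j)

theorem iteratedDeriv_localInterp (r : ℕ) (g : ℤ → ℝ) (n : ℤ) (i : ℕ) (s : ℝ) :
    iteratedDeriv i (localInterp r g n) s
      = ∑ j ∈ Finset.range (r + 2), (fwdDiff 1)^[j] g n * iteratedDeriv i (blendBasis r j) s := by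
  unfold localInterp
  rw [iteratedDeriv_fun_sum]
  · simp only [iteratedDeriv_const_mul_field]
  · exact fun j _ => (contDiff_const.mul (contDiff_blendBasis r j (n := (i : ℕ∞)))).contDiffAt

/-- The smooth interpolation of a sequence on the integers. -/
noncomputable def smoothInterp (r : ℕ) (g : ℤ → ℝ) (t : ℝ) : ℝ :=
  localInterp r g ⌊t⌋ (t - ⌊t⌋)

theorem smoothInterp_intCast (r : ℕ) (g : ℤ → ℝ) (n : ℤ) : smoothInterp r g n = g n := by
  simp [smoothInterp, localInterp_zero]

theorem smoothInterp_eq_localInterp (r : ℕ) (g : ℤ → ℝ) {n : ℤ} {t : ℝ}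
    (h1 : (n : ℝ) - 1 / 4 < t) (h2 : t < n + 5 / 4) :
    smoothInterp r g t = localInterp r g n (t - n) := by
  have hle : n - 1 ≤ ⌊t⌋ := Int.le_floor.2 (by push_cast; linarith)
  have hlt : ⌊t⌋ < n + 2 := Int.floor_lt.2 (by push_cast; linarith)
  have hf1 := Int.floor_le t
  have hf2 := Int.lt_floor_add_one t
  obtain h | h | h : ⌊t⌋ = n - 1 ∨ ⌊t⌋ = n ∨ ⌊t⌋ = n + 1 := by omega
  · rw [h] at hf1 hf2
    push_cast at hf1 hf2
    rw [smoothInterp, h, ← localInterp_succ r g (n - 1) (by push_cast; linarith)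
      (by push_cast; linarith)]
    congr 1
    · omega
    · push_cast
      ring
  · rw [smoothInterp, h]
  · rw [h] at hf1 hf2
    push_cast at hf1 hf2
    rw [smoothInterp, h, ← localInterp_succ r g n (by linarith) (by linarith)]
    congr 1
    push_cast
    ring

theorem smoothInterp_eventuallyEq (r : ℕ) (g : ℤ → ℝ) (t : ℝ) :
    smoothInterp r g =ᶠ[nhds t] fun u => localInterp r g ⌊t⌋ (u - ⌊t⌋) := by
  have h1 := Int.floor_le t
  have h2 := Int.lt_floor_add_one t
  filter_upwards [Ioo_mem_nhds (by linarith : (⌊t⌋ : ℝ) - 1 / 4 < t)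
    (by linarith : t < (⌊t⌋ : ℝ) + 5 / 4)] with u hu
  exact smoothInterp_eq_localInterp r g hu.1 hu.2

theorem contDiff_smoothInterp (r : ℕ) (g : ℤ → ℝ) {m : ℕ∞} : ContDiff ℝ m (smoothInterp r g) := by
  refine contDiff_iff_contDiffAt.2 fun t => ?_
  refine ContDiffAt.congr_of_eventuallyEq ?_ (smoothInterp_eventuallyEq r g t)
  exact ((contDiff_localInterp r g ⌊t⌋).comp (contDiff_id.sub contDiff_const)).contDiffAt

theorem iteratedDeriv_smoothInterp (r : ℕ) (g : ℤ → ℝ) (i : ℕ) (t : ℝ) :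
    iteratedDeriv i (smoothInterp r g) t
      = iteratedDeriv i (localInterp r g ⌊t⌋) (t - ⌊t⌋) := by
  rw [(smoothInterp_eventuallyEq r g t).iteratedDeriv_eq,
    iteratedDeriv_comp_sub_const i (localInterp r g ⌊t⌋) (⌊t⌋ : ℝ)]

theorem exists_abs_iteratedDeriv_smoothInterp_le {r : ℕ} {g : ℤ → ℝ} {i : ℕ} (hi : i ≤ r) {q : ℝ}
    (hq : 0 ≤ q)
    (h : ∀ j, i ≤ j → j ≤ r + 1 → ∃ c : ℝ, 0 < c ∧ ∀ n : ℤ,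
      |(fwdDiff 1)^[j] g n| ≤ c * (1 + |(n : ℝ)|) ^ (-q)) :
    ∃ c : ℝ, 0 < c ∧ ∀ t : ℝ,
      |iteratedDeriv i (smoothInterp r g) t| ≤ c * (1 + |t|) ^ (-q) := by
  have hterm : ∀ j ∈ Finset.range (r + 2), ∃ c : ℝ, 0 < c ∧ ∀ n : ℤ, ∀ s ∈ Set.Icc (0 : ℝ) 1,
      |(fwdDiff 1)^[j] g n * iteratedDeriv i (blendBasis r j) s|
        ≤ c * (1 + |(n : ℝ)|) ^ (-q) := by
    intro j hj
    rcases lt_or_ge j i with hji | hji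
    · refine ⟨1, one_pos, fun n s _ => ?_⟩
      rw [iteratedDeriv_blendBasis_of_lt hji hi]
      simp only [Pi.zero_apply, mul_zero, abs_zero]
      positivity
    · obtain ⟨c, hc, hb⟩ := h j hji (by have := Finset.mem_range.1 hj; omega)
      obtain ⟨K, hK⟩ := (isCompact_Icc (a := (0 : ℝ)) (b := 1)).exists_bound_of_continuousOn
        ((contDiff_blendBasis r j (n := ⊤)).continuous_iteratedDeriv i
          (by exact_mod_cast le_top)).continuousOn
      refine ⟨c * (|K| + 1), by positivity, fun n s hs => ?_⟩
      have hKs : |iteratedDeriv i (blendBasis r j) s| ≤ |K| + 1 :=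
        (hK s hs).trans ((le_abs_self K).trans (by linarith))
      rw [abs_mul]
      calc _ ≤ (c * (1 + |(n : ℝ)|) ^ (-q)) * (|K| + 1) :=
            mul_le_mul (hb n) hKs (abs_nonneg _) (by positivity)
        _ = _ := by ring
  choose! c hc hb using hterm
  refine ⟨(∑ j ∈ Finset.range (r + 2), c j) * 2 ^ q,
    mul_pos (Finset.sum_pos hc (by simp)) (by positivity), fun t => ?_⟩
  have h1 := Int.floor_le t
  have h2 := Int.lt_floor_add_one t
  have hs : t - ⌊t⌋ ∈ Set.Icc (0 : ℝ) 1 := ⟨by linarith, by linarith⟩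
  have hle : |t| ≤ |(⌊t⌋ : ℝ)| + 1 := by
    have h3 := abs_add_le (⌊t⌋ : ℝ) (t - ⌊t⌋)
    rw [add_sub_cancel, abs_of_nonneg hs.1] at h3
    linarith [hs.2]
  rw [iteratedDeriv_smoothInterp, iteratedDeriv_localInterp, mul_assoc]
  refine (Finset.abs_sum_le_sum_abs _ _).trans
    ((Finset.sum_le_sum fun j hj => hb j hj ⌊t⌋ _ hs).trans ?_)
  rw [← Finset.sum_mul]
  exact mul_le_mul_of_nonneg_left (rpow_neg_le_mul_of_abs_le_add_one hq hle)
    (Finset.sum_nonneg fun j hj => (hc j hj).le)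

/-! ### From derivatives to differences -/

/-- Induct through `fwdDiff 1 α`: its `r`-th derivative is a unit increment of that of `α`, so the
mean value inequality applies. -/
theorem abs_fwdDiff_iterate_le_of_iteratedDeriv (r : ℕ) {α : ℝ → ℝ} (hα : ContDiff ℝ (r : ℕ∞) α)
    {a M : ℝ} (h : ∀ t, a ≤ t → |iteratedDeriv r α t| ≤ M) {t : ℝ} (ht : a ≤ t) :
    |(fwdDiff 1)^[r] α t| ≤ M := by
  induction r generalizing α t with
  | zero => simpa using h t ht
  | succ r ih =>
    have hα' : ContDiff ℝ (r : ℕ∞) α := hα.of_le (by exact_mod_cast Nat.le_succ r)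
    have hs : ContDiff ℝ (r : ℕ∞) (fun u => α (u + 1)) :=
      hα'.comp (contDiff_id.add contDiff_const)
    rw [Function.iterate_succ_apply]
    refine ih (hs.sub hα') (fun u hu => ?_) ht
    have hd : Differentiable ℝ (iteratedDeriv r α) :=
      hα.differentiable_iteratedDeriv r (by exact_mod_cast Nat.lt_succ_self r)
    have heq : iteratedDeriv r (fwdDiff 1 α) u
        = iteratedDeriv r α (u + 1) - iteratedDeriv r α u := by
      have := iteratedDeriv_sub (n := r) (x := u) (f := fun u => α (u + 1)) (g := α)
        hs.contDiffAt hα'.contDiffAt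
      rw [iteratedDeriv_comp_add_const] at this
      exact this
    have hmv := (convex_Ici a).norm_image_sub_le_of_norm_deriv_le (f := iteratedDeriv r α) (C := M)
      (fun x _ => hd x) (fun x hx => by rw [← iteratedDeriv_succ]; exact h x hx) hu
      (show u + 1 ∈ Set.Ici a from hu.trans (by linarith))
    refine (congrArg abs heq).trans_le ?_
    simpa using hmv

theorem fwdDiff_iterate_natCast_add (α : ℝ → ℝ) (b : ℝ) (r l : ℕ) :
    (fwdDiff 1)^[r] (fun m : ℕ => α (m + b)) l = (fwdDiff 1)^[r] α (l + b) := by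
  induction r generalizing l with
  | zero => rfl
  | succ r ih =>
    rw [Function.iterate_succ_apply', Function.iterate_succ_apply', fwdDiff, fwdDiff, ih, ih]
    congr 2
    rw [Nat.cast_add, Nat.cast_one, add_right_comm]

theorem lemma4p3 (r : ℕ) (A : ℕ → ℝ) (hA : ∀ l, 0 ≤ A l) (β : ℝ) (hβ : 0 < β) :
    (Filter.Tendsto A Filter.atTop (nhds 0) ∧
      ∃ c : ℝ, 0 < c ∧ ∀ l : ℕ,
        |(fwdDiff 1)^[r] (fun m : ℕ => √(A m)) l| ≤ c * (1 + (l : ℝ)) ^ (-(1 + β + (r : ℝ))))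
    ↔
    ∃ α : ℝ → ℝ, Function.Even α ∧ ContDiff ℝ (r : ℕ∞) α ∧
      (∀ n : ℤ, α ((n : ℝ) + 1 / 2) = halfIntSeq A n) ∧
      ∃ c : ℝ, 0 < c ∧ ∀ i : ℕ, i ≤ r → ∀ t : ℝ,
        |iteratedDeriv i α t| ≤ c * (1 + |t|) ^ (-(1 + β + (i : ℝ))) := by
  constructor
  · rintro ⟨hlim, hdiff⟩
    set f : ℕ → ℝ := fun m => √(A m) with hf
    have hf0 : Filter.Tendsto f Filter.atTop (nhds 0) := by
      have := (Real.continuous_sqrt.tendsto 0).comp hlim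
      rw [Real.sqrt_zero] at this
      exact this
    set γ := smoothInterp r (zeroExtend f) with hγ
    have hγc : ContDiff ℝ (r : ℕ∞) γ := contDiff_smoothInterp r _
    have hγd : ∀ i, i ≤ r → ∃ c : ℝ, 0 < c ∧ ∀ t : ℝ,
        |iteratedDeriv i γ t| ≤ c * (1 + |t|) ^ (-(1 + β + (i : ℝ))) := by
      intro i hi
      refine exists_abs_iteratedDeriv_smoothInterp_le hi (by positivity) fun j hij hj => ?_
      refine exists_abs_fwdDiff_iterate_zeroExtend_le ?_
      have hweak : ∀ k, i ≤ k → k ≤ r → ∃ c : ℝ, 0 < c ∧ ∀ l : ℕ,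
          |(fwdDiff 1)^[k] f l| ≤ c * (1 + (l : ℝ)) ^ (-(1 + β + (i : ℝ))) := by
        intro k hik hk
        obtain ⟨c, hc, hb⟩ := exists_abs_fwdDiff_iterate_le_of_le hβ hf0 hdiff hk
        refine ⟨c, hc, fun l => (hb l).trans ?_⟩
        gcongr
        linarith [Nat.cast_nonneg (α := ℝ) l]
      rcases hj.lt_or_eq with hj | rfl
      · exact hweak j hij (by omega)
      · exact exists_abs_fwdDiff_iterate_succ_le (by positivity) (hweak r hi le_rfl)
    choose! c hc hb using hγd
    have hs1 : ContDiff ℝ (r : ℕ∞) (fun t => γ (t - 1 / 2)) :=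
      hγc.comp (contDiff_id.sub contDiff_const)
    have hs2 : ContDiff ℝ (r : ℕ∞) (fun t => γ (-t - 1 / 2)) := hs1.comp contDiff_neg
    -- At each half-integer exactly one summand samples `γ` at a negative integer, where it
    -- vanishes. In the constant, `2` counts the summands, the power of `2` pays for the half shift,
    -- and the sum over `i` serves all orders at once.
    refine ⟨fun t => γ (t - 1 / 2) + γ (-t - 1 / 2), fun t => ?_, hs1.add hs2, fun n => ?_,
      ∑ i ∈ Finset.range (r + 1), 2 * c i * 2 ^ (1 + β + (i : ℝ)), ?_, fun i hi t => ?_⟩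
    · simp only [neg_neg]; ring
    · have h1 : (n : ℝ) + 1 / 2 - 1 / 2 = n := by ring
      have h2 : -((n : ℝ) + 1 / 2) - 1 / 2 = ((-n - 1 : ℤ) : ℝ) := by push_cast; ring
      simp only [h1, h2, hγ, smoothInterp_intCast]
      cases n with
      | ofNat m =>
        rw [zeroExtend_of_neg f (n := -Int.ofNat m - 1) (by simp; omega)]
        simp [zeroExtend, halfIntSeq, hf]
      | negSucc m =>
        rw [zeroExtend_of_neg f (Int.negSucc_lt_zero m),
          show -Int.negSucc m - 1 = (m : ℤ) by omega, zeroExtend_natCast]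
        simp [halfIntSeq, hf]
    · refine Finset.sum_pos (fun i hi => ?_) (by simp)
      have := hc i (by simpa [Nat.lt_succ_iff] using hi)
      positivity
    · have hir : (i : WithTop ℕ∞) ≤ ((r : ℕ∞) : WithTop ℕ∞) := by exact_mod_cast hi
      have hq : 0 ≤ 1 + β + (i : ℝ) := by positivity
      have hbd : ∀ u : ℝ, |t| ≤ |u| + 1 → |iteratedDeriv i γ u|
          ≤ c i * 2 ^ (1 + β + (i : ℝ)) * (1 + |t|) ^ (-(1 + β + (i : ℝ))) := fun u hu => by
        refine (hb i hi u).trans ?_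
        rw [mul_assoc]
        exact mul_le_mul_of_nonneg_left (rpow_neg_le_mul_of_abs_le_add_one hq hu) (hc i hi).le
      rw [iteratedDeriv_fun_add (hs1.of_le hir).contDiffAt (hs2.of_le hir).contDiffAt,
        iteratedDeriv_comp_neg i (fun t => γ (t - 1 / 2)) t, iteratedDeriv_comp_sub_const]
      have h1 := hbd (t - 1 / 2) (by
        have := abs_sub_abs_le_abs_sub t (1 / 2)
        rw [abs_of_pos (by norm_num : (0 : ℝ) < 1 / 2)] at this
        linarith)
      have h2 := hbd (-t - 1 / 2) (by
        have := abs_sub_abs_le_abs_sub (-t) (1 / 2)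
        rw [abs_of_pos (by norm_num : (0 : ℝ) < 1 / 2), abs_neg] at this
        linarith)
      have h3 : |(-1 : ℝ) ^ i • iteratedDeriv i γ (-t - 1 / 2)|
          = |iteratedDeriv i γ (-t - 1 / 2)| := by simp [abs_mul]
      have h4 : 2 * c i * 2 ^ (1 + β + (i : ℝ))
          ≤ ∑ i ∈ Finset.range (r + 1), 2 * c i * 2 ^ (1 + β + (i : ℝ)) :=
        Finset.single_le_sum (f := fun i : ℕ => 2 * c i * (2 : ℝ) ^ (1 + β + (i : ℝ)))
          (fun k hk => by
            have := hc k (by simpa [Nat.lt_succ_iff] using hk)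
            positivity) (by simpa [Nat.lt_succ_iff] using hi)
      refine (abs_add_le _ _).trans ?_
      rw [h3]
      refine (add_le_add h1 h2).trans (le_of_eq_of_le ?_
        (mul_le_mul_of_nonneg_right h4 (by positivity)))
      ring
  · rintro ⟨α, -, hα, hval, c, hc, hb⟩
    have hfα : (fun m : ℕ => √(A m)) = fun m : ℕ => α (m + 1 / 2) := by
      ext m
      exact (hval (m : ℤ)).symm
    have hsqrt : Filter.Tendsto (fun m : ℕ => √(A m)) Filter.atTop (nhds 0) := by
      rw [hfα]
      refine squeeze_zero_norm (a := fun m : ℕ => c * (1 + |(m : ℝ) + 1 / 2|) ^ (-(1 + β)))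
        (fun m => by simpa using hb 0 (Nat.zero_le r) (m + 1 / 2)) ?_
      rw [← mul_zero c]
      refine Filter.Tendsto.const_mul _ ((tendsto_rpow_neg_atTop (by positivity)).comp ?_)
      refine Filter.tendsto_atTop_mono (fun m => ?_) tendsto_natCast_atTop_atTop
      linarith [le_abs_self ((m : ℝ) + 1 / 2)]
    refine ⟨?_, c, hc, fun l => ?_⟩
    · simpa [Real.sq_sqrt (hA _)] using hsqrt.pow 2
    · rw [hfα, fwdDiff_iterate_natCast_add]
      -- Starting the half-line at `l` rather than `l + 1/2` gives the weight `1 + l` directly.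
      refine abs_fwdDiff_iterate_le_of_iteratedDeriv r hα (a := l) (fun t ht => ?_) (by simp)
      refine (hb r le_rfl t).trans ?_
      gcongr c * ?_
      exact Real.rpow_le_rpow_of_nonpos (by positivity) (by linarith [le_abs_self t])
        (by have : (0 : ℝ) ≤ r := r.cast_nonneg
            linarith)
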